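/- Let $G=(V,E)$ be a finite directed acyclic graph. A path between $u$ and $v$ is a sequence of distinct vertices from $u$ to $v$ in which consecutive vertices are joined by an edge of either direction; its intermediate vertices are those other than $u,v$; an intermediate vertex $w$ is a collider of the path if both path edges at $w$ point into $w$. Write $\mathrm{An}_G(A)$ for $A$ together with all ancestors of its elements, and $an_G(A)=\mathrm{An}_G(A)\setminus A$. Write $mb_G(u)$ for the set of parents of $u$, children of $u$ and parents of children of $u$, without $u$ itself. Write $G_A$ for the subgraph induced on $A$. For $H\subseteq V$, an *inducing path* of $H$ in $G$ is a path between two distinct non-adjacent vertices $u,v\in H$ whose intermediate vertices in $H$ are all colliders and whose colliders all lie in $an_G(\{u,v\})$; then $\{u,v\}$ is called an *i-pair* of $H$ in $G$, and $\mathcal I_G(H)$ is the set of all i-pairs. The subgraph $G_H$ is *d-convex* in $G$ if $H$ has no inducing path in $G$. The *d-convex hull* of $R\subseteq V$ is the smallest d-convex subgraph of $G$ containing $R$. A set $M\subseteq V\setminus H$ is *d-connected* in $G$ with respect to $H$ if any two distinct vertices of $M$ are joined by a path in $G$ whose intermediate vertices in $H$ are all colliders; it is a *d-connected component* with respect to $H$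 if it is inclusion-maximal among the d-connected subsets of $V\setminus H$. For non-adjacent $u,v$, let $K=G_{\mathrm{An}_G(\{u,v\})}$ and let $S_u$ be the set of those $z\in mb_K(u)$ for which some path in $K$ from $v$ to $z$ has all its intermediate vertices in $mb_K(u)$ as colliders (the close minimal $uv$-d-separator returned by the algorithm FCMDS). Define $S_v$ by exchanging $u$ and $v$. The algorithm CMDSA takes $G$ and $R\subseteq V$ as input and starts with $H:=R$. It repeats the following pass until $\mathcal I_G(H)=\emptyset$ holds at the end of a pass: for each d-connected component $M$ of $G_{\mathrm{An}_G(R)}$ with respect to the set $H$ at the start of the pass (in any order), put $\mathcal Q:=\mathcal I_{G_{M\cup H}}(H)$ for the current $H$, and then, for each pair $\{u,v\}\in\mathcal Q$ (in any order), replace $H$ by $H\cup S_u\cup S_v$. Finally it returns $G_H$. **Theorem.** For every finite directed acyclic graph $G=(V,E)$ and every $R\subseteq V$, the algorithm CMDSA is correct: whatever the orders in which components and pairs are processed, it terminates, and the induced subgraph $G_H$ that it returns is the d-convex hull of $R$ in $G$. -/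

import Mathlib

/-- A finite directed acyclic graph whose vertices are elements of `V`. The vertex set is carried
explicitly, so that a graph and its induced subgraphs live over the same type. -/
@[ext]
structure FinDAG (V : Type*) where
  verts : Set V
  edge : V → V → Prop
  finite_verts : verts.Finite
  edge_mem : ∀ u v, edge u v → u ∈ verts ∧ v ∈ verts
  acyclic : ∀ v, ¬ Relation.TransGen edge v v

namespace FinDAG

variable {V : Type*}

/-- Adjacency: an edge in one of the two directions. -/
def Adj (G : FinDAG V) (u v : V) : Prop := G.edge u v ∨ G.edge v u

/-- The parents of `v`. -/
def pa (G : FinDAG V) (v : V) : Set V := {u | G.edge u v}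

/-- The children of `v`. -/
def ch (G : FinDAG V) (v : V) : Set V := {w | G.edge v w}

/-- The ancestors of `v`: the vertices with a directed path of length at least one to `v`. -/
def ancestors (G : FinDAG V) (v : V) : Set V := {u | Relation.TransGen G.edge u v}

/-- The ancestor closure `An(A)`. -/
def An (G : FinDAG V) (A : Set V) : Set V := (⋃ v ∈ A, G.ancestors v) ∪ A

/-- The ancestor set `an(A)` of a set, which excludes `A` itself. -/
def an (G : FinDAG V) (A : Set V) : Set V := G.An A \ A

/-- The Markov boundary of a single vertex: its parents, its children, and the other parents of
its children. -/
def mb (G : FinDAG V) (u : V) : Set V :=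
  (G.pa u ∪ G.ch u ∪ ⋃ w ∈ G.ch u, G.pa w) \ {u}

/-- The induced subgraph on (the vertices of `G` lying in) `A`. -/
def induce (G : FinDAG V) (A : Set V) : FinDAG V where
  verts := G.verts ∩ A
  edge u v := G.edge u v ∧ u ∈ A ∧ v ∈ A
  finite_verts := G.finite_verts.subset Set.inter_subset_left
  edge_mem u v h :=
    ⟨⟨(G.edge_mem u v h.1).1, h.2.1⟩, ⟨(G.edge_mem u v h.1).2, h.2.2⟩⟩
  acyclic v h := G.acyclic v (Relation.TransGen.mono (fun _ _ h' => h'.1) v v h)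

/-- The subgraph relation. -/
def IsSubgraph (K K' : FinDAG V) : Prop :=
  K.verts ⊆ K'.verts ∧ ∀ u v, K.edge u v → K'.edge u v

/-- `l` is the list of vertices of a path from `u` to `v` : distinct vertices, consecutive ones
adjacent (in either direction). -/
def IsPath (G : FinDAG V) (u v : V) (l : List V) : Prop :=
  l.head? = some u ∧ l.getLast? = some v ∧ l.Nodup ∧ l.IsChain G.Adj ∧ ∀ w ∈ l, w ∈ G.verts

/-- The intermediate vertices of a path `l` from `u` to `v`. -/
def pathInner (u v : V) (l : List V) : Set V := {w | w ∈ l} \ {u, v}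

/-- The colliders of a path `l` : the `w` for which `w₁ → w ← w₂` occurs in consecutive
positions of `l`. -/
def colliders (G : FinDAG V) (l : List V) : Set V :=
  {w | ∃ w₁ w₂, [w₁, w, w₂] <:+: l ∧ G.edge w₁ w ∧ G.edge w₂ w}

/-- `M` is d-connected in `G` with respect to `R`. -/
def DConnected (G : FinDAG V) (R M : Set V) : Prop :=
  M ⊆ G.verts \ R ∧
    ∀ u ∈ M, ∀ v ∈ M, u ≠ v →
      ∃ l, G.IsPath u v l ∧ pathInner u v l ∩ R ⊆ G.colliders l

/-- `M` is a d-connected component of `G` with respect to `R`: a maximal d-connected set. -/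
def IsDComponent (G : FinDAG V) (R M : Set V) : Prop :=
  G.DConnected R M ∧ ∀ M', M ⊂ M' → ¬ G.DConnected R M'

/-- `l` is an inducing path of `R` connecting the distinct non-adjacent vertices `u, v` of `R`. -/
def IsInducingPath (G : FinDAG V) (R : Set V) (u v : V) (l : List V) : Prop :=
  u ∈ R ∧ v ∈ R ∧ u ≠ v ∧ ¬ G.Adj u v ∧ G.IsPath u v l ∧
    R ∩ pathInner u v l ⊆ G.colliders l ∧ G.colliders l ⊆ G.an {u, v}

/-- The set of information pairs (i-pairs) of `R` in `G`, as unordered pairs. -/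
def iPairs (G : FinDAG V) (R : Set V) : Set (Sym2 V) :=
  {p | ∃ u v l, p = s(u, v) ∧ G.IsInducingPath R u v l}

/-- The subgraph `K` of `G` is d-convex: it is induced by a set `H` of vertices without
inducing path. -/
def IsDConvexSubgraph (G K : FinDAG V) : Prop :=
  ∃ H, H ⊆ G.verts ∧ K = G.induce H ∧ ¬ ∃ u v l, G.IsInducingPath H u v l

/-- `K` is the d-convex hull of `R` in `G`: the smallest d-convex subgraph containing `R`. -/
def IsDConvexHull (G : FinDAG V) (R : Set V) (K : FinDAG V) : Prop :=
  G.IsDConvexSubgraph K ∧ R ⊆ K.verts ∧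
    ∀ K', G.IsDConvexSubgraph K' → R ⊆ K'.verts → K.IsSubgraph K'

/-- The vertices `z` that can be reached from `v` in `G` by a path none of whose intermediate
non-colliders lies in `W`. -/
def reachable (G : FinDAG V) (v : V) (W : Set V) : Set V :=
  {z | ∃ l, G.IsPath v z l ∧ W ∩ pathInner v z l ⊆ G.colliders l}

/-- The output of FCMDS on `G` and the non-adjacent vertices `u, v` : the minimal d-separator of
`u` and `v` close to `u`, computed inside the induced subgraph on `An({u, v})` as the Markov
boundary of `u` intersected with the set reachable from `v` given this boundary. -/
def fcmds (G : FinDAG V) (u v : V) : Set V :=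
  (G.induce (G.An {u, v})).mb u ∩
    (G.induce (G.An {u, v})).reachable v ((G.induce (G.An {u, v})).mb u)

/-- The union `S_u ∪ S_v` of the two close minimal d-separators of an unordered pair. -/
def closeSeparators (G : FinDAG V) : Sym2 V → Set V :=
  Sym2.lift ⟨fun u v => G.fcmds u v ∪ G.fcmds v u, fun _ _ => Set.union_comm _ _⟩

/-- The inner loop over a list `Q` of pairs: each pair replaces the current `H` by
`H ∪ S_u ∪ S_v`. -/
def absorb (G : FinDAG V) (Q : List (Sym2 V)) (H : Set V) : Set V :=
  Q.foldl (fun H p => H ∪ G.closeSeparators p) H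

/-- The loop over the d-connected components. `G.ComponentLoop Ms H H'` says that processing the
components `Ms` one after the other can turn `H` into `H'`. For each component `M`, the list `Q`
enumerates, in an arbitrary order, the i-pairs of the current `H` in the subgraph induced on
`M ∪ H`. -/
inductive ComponentLoop (G : FinDAG V) : List (Set V) → Set V → Set V → Prop
  | nil (H : Set V) : ComponentLoop G [] H H
  | cons (M : Set V) (Ms : List (Set V)) (H H' : Set V) (Q : List (Sym2 V)) :
      Q.Nodup → (∀ p, p ∈ Q ↔ p ∈ (G.induce (M ∪ H)).iPairs H) →
      ComponentLoop G Ms (G.absorb Q H) H' → ComponentLoop G (M :: Ms) H H'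

/-- One execution of the body of the repeat loop of CMDSA, started with `H`, can end with `H'`.
The d-connected components, with respect to `H`, of the subgraph induced on `An(R)` are
enumerated in an arbitrary order. -/
def CMDSAPass (G : FinDAG V) (R H H' : Set V) : Prop :=
  ∃ Ms : List (Set V), Ms.Nodup ∧
    (∀ M, M ∈ Ms ↔ (G.induce (G.An R)).IsDComponent H M) ∧ G.ComponentLoop Ms H H'

/-- The repeat-until loop of CMDSA, started with a set `H`, can end with a set `H'`. -/
inductive CMDSALoop (G : FinDAG V) (R : Set V) : Set V → Set V → Prop
  | finish (H H' : Set V) : G.CMDSAPass R H H' → G.iPairs H' = ∅ → CMDSALoop G R H H'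
  | again (H H' H'' : Set V) : G.CMDSAPass R H H' → G.iPairs H' ≠ ∅ →
      CMDSALoop G R H' H'' → CMDSALoop G R H H''

/-- CMDSA with input `G, R` can return the graph `K`. -/
def CMDSAReturns (G : FinDAG V) (R : Set V) (K : FinDAG V) : Prop :=
  ∃ H, G.CMDSALoop R R H ∧ K = G.induce H

/-- CMDSA with input `G, R` can run forever: the repeat loop is executed infinitely often without
its exit condition ever becoming true. -/
def CMDSADiverges (G : FinDAG V) (R : Set V) : Prop :=
  ∃ f : ℕ → Set V, f 0 = R ∧
    ∀ k, G.CMDSAPass R (f k) (f (k + 1)) ∧ G.iPairs (f (k + 1)) ≠ ∅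

end FinDAG

/-! The proof replaces paths by walks in moral graphs. Two non-adjacent vertices of `H` are the ends
of an inducing path exactly when a walk avoiding `H` joins them in the moral graph of their
ancestral closure (`moralConvex_iff`).

The main fact is `MoralConvex.moralAdj`. Let `H` be convex and let every vertex of an ancestral set
`A` descend inside `A` to `H`. Then a walk outside `H` in the moral graph of `A` joins only morally
adjacent vertices of `H`. The reason is `MoralConvex.exists_dominating`: each connected piece
outside `H` is already connected among the ancestors of a single `t ∈ H`, and its neighbours in `H`
are `t` or parents of `t`.

This has two consequences. A convex set contains the close separators of its non-adjacent pairs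
(`MoralConvex.mem_of_moralReach`), so the algorithm never leaves a convex superset of `R`, which
gives minimality. Convexity can also be tested one component at a time
(`moralConvex_of_components`).

Conversely, the separator of an i-pair always has a vertex outside `H`
(`IsInducingPath.not_fcmds_subset`). A pass that adds nothing therefore certifies convexity, and a
pass that fails the exit test enlarges `H` strictly. Finiteness then gives termination. -/

namespace FinDAG

variable {V : Type*}

/-- `A` is closed under taking parents. -/
def Ancestral (G : FinDAG V) (A : Set V) : Prop := ∀ x y, G.edge x y → y ∈ A → x ∈ A

/-- `x` and `y` are equal or adjacent in the moral graph of the ancestral set `A`; the witness `c`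
is `x`, `y` or a common child. -/
def MoralAdj (G : FinDAG V) (A : Set V) (x y : V) : Prop :=
  ∃ c ∈ A, (x = c ∨ G.edge x c) ∧ (y = c ∨ G.edge y c)

/-- `x` and `y` are joined by a walk in the moral graph of `A` whose intermediate vertices avoid
`W`. -/
inductive MoralReach (G : FinDAG V) (A W : Set V) (x : V) : V → Prop
  | base {y : V} : G.MoralAdj A x y → MoralReach G A W x y
  | step {y z : V} : MoralReach G A W x y → y ∉ W → G.MoralAdj A y z → MoralReach G A W x z

/-- Two distinct vertices of `H` joined in the moral graph of their ancestral closure outside of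
`H` are adjacent. -/
def MoralConvex (G : FinDAG V) (H : Set V) : Prop :=
  ∀ a ∈ H, ∀ b ∈ H, a ≠ b → G.MoralReach (G.An {a, b}) H a b → G.Adj a b

theorem mem_An {G : FinDAG V} {A : Set V} {x : V} :
    x ∈ G.An A ↔ ∃ v ∈ A, Relation.ReflTransGen G.edge x v := by
  simp only [An, ancestors, Set.mem_union, Set.mem_iUnion, Set.mem_ofPred_eq, exists_prop]
  constructor
  · rintro (⟨v, hv, h⟩ | h)
    · exact ⟨v, hv, h.to_reflTransGen⟩
    · exact ⟨x, h, .refl⟩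
  · rintro ⟨v, hv, h⟩
    rcases Relation.reflTransGen_iff_eq_or_transGen.1 h with rfl | h
    · exact .inr hv
    · exact .inl ⟨v, hv, h⟩

theorem subset_An (G : FinDAG V) (A : Set V) : A ⊆ G.An A := fun _ h => .inr h

theorem ancestral_An (G : FinDAG V) (A : Set V) : G.Ancestral (G.An A) := by
  intro x y hxy hy
  obtain ⟨v, hv, h⟩ := mem_An.1 hy
  exact mem_An.2 ⟨v, hv, .head hxy h⟩

theorem Ancestral.reflTransGen_mem {G : FinDAG V} {A : Set V} (hA : G.Ancestral A) {x y : V}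
    (h : Relation.ReflTransGen G.edge x y) (hy : y ∈ A) : x ∈ A := by
  induction h using Relation.ReflTransGen.head_induction_on with
  | refl => exact hy
  | head hab _ ih => exact hA _ _ hab ih

theorem Ancestral.An_subset {G : FinDAG V} {A B : Set V} (hA : G.Ancestral A) (h : B ⊆ A) :
    G.An B ⊆ A := by
  intro x hx
  obtain ⟨v, hv, h'⟩ := mem_An.1 hx
  exact hA.reflTransGen_mem h' (h hv)

theorem ancestral_verts (G : FinDAG V) : G.Ancestral G.verts :=
  fun x y h _ => (G.edge_mem x y h).1

theorem An_mono (G : FinDAG V) {A B : Set V} (h : A ⊆ B) : G.An A ⊆ G.An B :=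
  (G.ancestral_An B).An_subset (h.trans (G.subset_An B))

theorem edge_asymm (G : FinDAG V) {x y : V} (h : G.edge x y) : ¬ G.edge y x :=
  fun h' => G.acyclic x (.tail (.single h) h')

theorem not_edge_of_reflTransGen (G : FinDAG V) {x y : V}
    (h : Relation.ReflTransGen G.edge x y) : ¬ G.edge y x :=
  fun h' => G.acyclic y (.head' h' h)

/-! ### Moral adjacency and moral walks in ancestral sets -/

section Moral

variable {G : FinDAG V} {A B W : Set V} {x y z : V}

theorem MoralAdj.symm (h : G.MoralAdj A x y) : G.MoralAdj A y x := by
  obtain ⟨c, hc, h1, h2⟩ := h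
  exact ⟨c, hc, h2, h1⟩

theorem MoralAdj.mono (hAB : A ⊆ B) (h : G.MoralAdj A x y) : G.MoralAdj B x y := by
  obtain ⟨c, hc, h1⟩ := h
  exact ⟨c, hAB hc, h1⟩

theorem MoralAdj.refl (h : x ∈ A) : G.MoralAdj A x x := ⟨x, h, .inl rfl, .inl rfl⟩

theorem MoralAdj.of_edge (hxy : G.edge x y) (h : y ∈ A) : G.MoralAdj A x y :=
  ⟨y, h, .inr hxy, .inl rfl⟩

theorem MoralAdj.left_mem (hA : G.Ancestral A) (h : G.MoralAdj A x y) : x ∈ A := by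
  obtain ⟨c, hc, rfl | h1, -⟩ := h
  · exact hc
  · exact hA _ _ h1 hc

theorem MoralReach.mono (hAB : A ⊆ B) (h : G.MoralReach A W x y) : G.MoralReach B W x y := by
  induction h with
  | base h => exact .base (h.mono hAB)
  | step _ h2 h3 ih => exact .step ih h2 (h3.mono hAB)

theorem MoralReach.head (h : G.MoralAdj A x y) (hy : y ∉ W) (h' : G.MoralReach A W y z) :
    G.MoralReach A W x z := by
  induction h' with
  | base h2 => exact .step (.base h) hy h2
  | step _ h2 h3 ih => exact .step ih h2 h3

theorem MoralReach.symm (h : G.MoralReach A W x y) : G.MoralReach A W y x := by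
  induction h with
  | base h => exact .base h.symm
  | step _ h2 h3 ih => exact .head h3.symm h2 ih

theorem MoralReach.trans (h : G.MoralReach A W x y) (hy : y ∉ W) (h' : G.MoralReach A W y z) :
    G.MoralReach A W x z := by
  induction h' with
  | base h2 => exact .step h hy h2
  | step _ h2 h3 ih => exact .step ih h2 h3

theorem MoralReach.right_mem (hA : G.Ancestral A) (h : G.MoralReach A W x y) : y ∈ A := by
  cases h with
  | base h => exact h.symm.left_mem hA
  | step _ _ h => exact h.symm.left_mem hA

/-- A common child in this closure would be an ancestor of, or equal to, one of its own parents,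
which acyclicity forbids. -/
theorem MoralAdj.adj_of_pair (hne : x ≠ y) (h : G.MoralAdj (G.An {x, y}) x y) : G.Adj x y := by
  obtain ⟨c, hc, rfl | h1, rfl | h2⟩ := h
  · exact absurd rfl hne
  · exact .inr h2
  · exact .inl h1
  · obtain ⟨w, rfl | rfl, hw⟩ := mem_An.1 hc
    · exact absurd h1 (G.not_edge_of_reflTransGen hw)
    · exact absurd h2 (G.not_edge_of_reflTransGen hw)

/-- From every vertex of `A` one descends to a first vertex of `H`. -/
theorem exists_moralReach_first {H : Set V} (hA : G.Ancestral A) {c w : V}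
    (hcw : Relation.ReflTransGen G.edge c w) (hwH : w ∈ H) (hwA : w ∈ A) :
    ∃ h ∈ H, h ∈ A ∧ c ∈ G.An {h} ∧ G.MoralReach (G.An {h}) H c h ∧ (c ∈ H → c = h) := by
  induction hcw using Relation.ReflTransGen.head_induction_on with
  | refl =>
    have := G.subset_An {w} rfl
    exact ⟨w, hwH, hwA, this, .base (.refl this), fun _ => rfl⟩
  | @head a c hac hcw ih =>
    obtain ⟨h, hH, hhA, hc, hr, hch⟩ := ih
    by_cases haH : a ∈ H
    · have := G.subset_An {a} rfl
      exact ⟨a, haH, hA.reflTransGen_mem (.head hac hcw) hwA, this, .base (.refl this),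
        fun _ => rfl⟩
    · refine ⟨h, hH, hhA, G.ancestral_An _ _ _ hac hc, ?_, fun h => absurd h haH⟩
      by_cases hcH : c ∈ H
      · obtain rfl := hch hcH
        exact .base (.of_edge hac hc)
      · exact .head (.of_edge hac hc) hcH hr

theorem An_pair_left (a b : V) : G.An {a} ⊆ G.An {a, b} := G.An_mono (by simp)

theorem An_pair_right (a b : V) : G.An {b} ⊆ G.An {a, b} := G.An_mono (by simp)

theorem finite_An (G : FinDAG V) (h : A ⊆ G.verts) : (G.An A).Finite :=
  G.finite_verts.subset (G.ancestral_verts.An_subset h)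

/-- Outside of a convex set, a part of the moral graph that is connected in an ancestral set is
connected in the ancestral closure of a single vertex. -/
theorem MoralConvex.exists_dominating {H : Set V} (hH : G.MoralConvex H) (hHV : H ⊆ G.verts)
    (hA : G.Ancestral A)
    (hdesc : ∀ x ∈ A, ∃ h ∈ H, h ∈ A ∧ Relation.ReflTransGen G.edge x h)
    (hzA : z ∈ A) (hz : z ∉ H) :
    ∃ t ∈ H, t ∈ A ∧ G.MoralReach (G.An {t}) H z t ∧
      ∀ x, G.MoralReach A H z x → G.MoralReach (G.An {t}) H z x := by
  have hfirst : ∀ c ∈ A, ∃ h ∈ H, h ∈ A ∧ c ∈ G.An {h} ∧ G.MoralReach (G.An {h}) H c h ∧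
      (c ∈ H → c = h) := by
    intro c hc
    obtain ⟨w, hwH, hwA, hcw⟩ := hdesc c hc
    exact exists_moralReach_first hA hcw hwH hwA
  -- The candidates for `t`. One with the most ancestors is chosen, so that no edge leads from it to
  -- another candidate.
  let P : Set V := {h | h ∈ H ∧ h ∈ A ∧ G.MoralReach (G.An {h}) H z h}
  have hPfin : P.Finite := G.finite_verts.subset fun h hh => hHV hh.1
  have hPne : P.Nonempty := by
    obtain ⟨h, h1, h2, -, h3, -⟩ := hfirst z hzA
    exact ⟨h, h1, h2, h3⟩
  obtain ⟨t, ⟨htH, htA, hzt⟩, hmax⟩ := Set.exists_max_image P (fun h => (G.An {h}).ncard) hPfin hPne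
  have hmax' : ∀ h ∈ P, ¬ G.edge t h := by
    intro h hh hth
    have hsub : G.An {t} ⊆ G.An {h} := (G.ancestral_An _).An_subset (by
      rintro _ rfl
      exact G.ancestral_An _ _ _ hth (G.subset_An _ rfl))
    have hss : G.An {t} ⊂ G.An {h} := by
      refine ⟨hsub, fun hle => ?_⟩
      obtain ⟨v, rfl, hv⟩ := mem_An.1 (hle (G.subset_An _ rfl))
      exact G.not_edge_of_reflTransGen hv hth
    have := Set.ncard_lt_ncard hss (G.finite_An (by simpa using hHV hh.1))
    exact absurd (hmax h hh) (not_le.2 this)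
  -- The piece cannot leave `An {t}`. The witness `c` descends to a first `h ∈ H`, and `t`, `h` are
  -- joined outside `H` through `y`, hence equal or adjacent. The edge `t → h` would make `h` a
  -- better candidate, and `h → t` puts `c` among the ancestors of `t`.
  have key : ∀ y x, y ∉ H → G.MoralReach (G.An {t}) H z y → G.MoralAdj A y x →
      G.MoralAdj (G.An {t}) y x := by
    rintro y x hy hzy ⟨c, hcA, hyc, hxc⟩
    refine ⟨c, ?_, hyc, hxc⟩
    obtain ⟨h, hhH, hhA, hch, hr, hcH⟩ := hfirst c hcA
    have hyh : G.MoralReach (G.An {h}) H y h := by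
      rcases hyc with rfl | hyc
      · exact hr
      · by_cases hc : c ∈ H
        · obtain rfl := hcH hc
          exact .base (.of_edge hyc hch)
        · exact .head (.of_edge hyc hch) hc hr
    by_cases hth : t = h
    · rwa [hth]
    have hreach : G.MoralReach (G.An {t, h}) H t h :=
      (((hzt.symm.trans hz hzy)).mono (An_pair_left t h)).trans hy (hyh.mono (An_pair_right t h))
    rcases hH t htH h hhH hth hreach with he | he
    · have hsub : G.An {t} ⊆ G.An {h} := (G.ancestral_An _).An_subset (by
        rintro _ rfl
        exact G.ancestral_An _ _ _ he (G.subset_An _ rfl))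
      exact absurd he (hmax' h ⟨hhH, hhA, (hzy.mono hsub).trans hy hyh⟩)
    · exact (G.ancestral_An {t}).An_subset (by
        rintro _ rfl
        exact G.ancestral_An _ _ _ he (G.subset_An _ rfl)) hch
  refine ⟨t, htH, htA, hzt, fun x hx => ?_⟩
  have hzz : G.MoralReach (G.An {t}) H z z := .base (.refl (hzt.symm.right_mem (G.ancestral_An _)))
  induction hx with
  | base h => exact .base (key _ _ hz hzz h)
  | step _ h2 h3 ih => exact .step ih h2 (key _ _ h2 ih h3)

end Moral

/-! ### Convex sets, close separators and localisation to components -/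

section Convex

variable {G : FinDAG V} {A H : Set V}

/-- Vertices of a convex set that are joined in a moral graph outside of the set are morally
adjacent. -/
theorem MoralConvex.moralAdj (hH : G.MoralConvex H) (hHV : H ⊆ G.verts) (hA : G.Ancestral A)
    (hdesc : ∀ x ∈ A, ∃ h ∈ H, h ∈ A ∧ Relation.ReflTransGen G.edge x h) {a b : V}
    (ha : a ∈ H) (hb : b ∈ H) (hab : G.MoralReach A H a b) : G.MoralAdj A a b := by
  cases hab with
  | base h => exact h
  | @step z _ haz hz hzb =>
    -- The vertex `t` serves as the witness of moral adjacency: both ends turn out to be `t` or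
    -- parents of `t`.
    obtain ⟨t, htH, htA, hzt, hall⟩ :=
      hH.exists_dominating hHV hA hdesc (hzb.left_mem hA) hz
    have key : ∀ x ∈ H, G.MoralReach A H z x → x = t ∨ G.edge x t := by
      intro x hx hzx
      by_cases hxt : x = t
      · exact .inl hxt
      have hzx' := hall x hzx
      have hxA := hzx'.right_mem (G.ancestral_An _)
      have hr : G.MoralReach (G.An {x, t}) H x t :=
        (hzx'.symm.trans hz hzt).mono (An_pair_right x t)
      rcases hH x hx t htH hxt hr with he | he
      · exact .inr he
      · obtain ⟨v, rfl, hv⟩ := mem_An.1 hxA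
        exact absurd he (G.not_edge_of_reflTransGen hv)
    exact ⟨t, htA, key a ha haz.symm, key b hb (.base hzb)⟩

variable {u v : V}

theorem induce_edge {x y : V} (hA : G.Ancestral A) :
    (G.induce A).edge x y ↔ G.edge x y ∧ y ∈ A :=
  ⟨fun h => ⟨h.1, h.2.2⟩, fun h => ⟨h.1, hA _ _ h.1 h.2, h.2⟩⟩

theorem mem_mb_induce {x : V} (hA : G.Ancestral A) (hu : u ∈ A) (hx : x ∈ A) :
    x ∈ (G.induce A).mb u ↔ x ≠ u ∧ G.MoralAdj A x u := by
  simp only [mb, pa, ch, Set.mem_sdiff, Set.mem_union, Set.mem_iUnion, Set.mem_ofPred_eq,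
    Set.mem_singleton_iff, exists_prop, induce_edge hA, MoralAdj]
  constructor
  · rintro ⟨(h | h) | ⟨c, h1, h2⟩, hne⟩
    · exact ⟨hne, u, hu, .inr h.1, .inl rfl⟩
    · exact ⟨hne, x, hx, .inl rfl, .inr h.1⟩
    · exact ⟨hne, c, h1.2, .inr h2.1, .inr h1.1⟩
  · rintro ⟨hne, c, hc, rfl | h1, rfl | h2⟩
    · exact absurd rfl hne
    · exact ⟨.inl (.inr ⟨h2, hc⟩), hne⟩
    · exact ⟨.inl (.inl ⟨h1, hc⟩), hne⟩
    · exact ⟨.inr ⟨c, ⟨h2, hc⟩, h1, hc⟩, hne⟩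

theorem mem_mb_pair {x : V} :
    x ∈ (G.induce (G.An {u, v})).mb u ↔ x ≠ u ∧ G.MoralAdj (G.An {u, v}) x u := by
  have hA := G.ancestral_An {u, v}
  have hu : u ∈ G.An {u, v} := G.subset_An _ (by simp)
  by_cases hx : x ∈ G.An {u, v}
  · exact mem_mb_induce hA hu hx
  · refine ⟨fun h => absurd ?_ hx, fun h => absurd (h.2.left_mem hA) hx⟩
    rcases h.1 with (h | h) | h
    · exact h.2.1
    · exact h.2.2
    · simp only [Set.mem_iUnion] at h
      obtain ⟨c, -, h2⟩ := h
      exact h2.2.1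

theorem notMem_mb_pair (hne : u ≠ v) (hadj : ¬ G.Adj u v) :
    v ∉ (G.induce (G.An {u, v})).mb u :=
  fun h => hadj ((mem_mb_pair.1 h).2.symm.adj_of_pair hne)

/-- A convex set contains the close separators of its non-adjacent pairs. -/
theorem MoralConvex.mem_of_moralReach (hH : G.MoralConvex H) (hHV : H ⊆ G.verts)
    (hu : u ∈ H) (hv : v ∈ H) (hne : u ≠ v) (hadj : ¬ G.Adj u v) {z : V}
    (hz : z ∈ (G.induce (G.An {u, v})).mb u)
    (hr : G.MoralReach (G.An {u, v}) ((G.induce (G.An {u, v})).mb u) v z) : z ∈ H := by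
  by_contra hzH
  have hvmb := notMem_mb_pair hne hadj
  -- Here `p` is the last vertex of `H` met before `x` on the walk from `v`. It avoids the Markov
  -- boundary because the intermediate vertices do, and `v` does by non-adjacency. For `x = z ∉ H`,
  -- the walk from `p` through `z` to `u` would force `p` into the boundary.
  have key : ∀ x, G.MoralReach (G.An {u, v}) ((G.induce (G.An {u, v})).mb u) v x →
      x ≠ u ∧ ∃ p ∈ H, p ∉ (G.induce (G.An {u, v})).mb u ∧ p ≠ u ∧
        G.MoralReach (G.An {u, v}) H p x := by
    intro x hx
    induction hx with
    | base h =>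
      refine ⟨?_, v, hv, hvmb, hne.symm, .base h⟩
      rintro rfl
      exact hvmb (mem_mb_pair.2 ⟨hne.symm, h⟩)
    | @step y x _ hy hyx ih =>
      obtain ⟨hyu, p, hp, hpmb, hpu, hpy⟩ := ih
      refine ⟨?_, ?_⟩
      · rintro rfl
        exact hy (mem_mb_pair.2 ⟨hyu, hyx⟩)
      · by_cases hyH : y ∈ H
        · exact ⟨y, hyH, hy, hyu, .base hyx⟩
        · exact ⟨p, hp, hpmb, hpu, .step hpy hyH hyx⟩
  obtain ⟨-, p, hp, hpmb, hpu, hpz⟩ := key z hr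
  refine hpmb (mem_mb_pair.2 ⟨hpu, ?_⟩)
  refine hH.moralAdj hHV (G.ancestral_An _) ?_ hp hu (.step hpz hzH (mem_mb_pair.1 hz).2)
  intro x hx
  obtain ⟨w, hw, hxw⟩ := mem_An.1 hx
  refine ⟨w, ?_, G.subset_An _ hw, hxw⟩
  rcases hw with rfl | rfl <;> assumption

/-- If `u` and `v` are joined outside of `H`, then the separator close to `u` has a vertex outside
of `H`. -/
theorem exists_mb_of_moralReach (hne : u ≠ v) (hadj : ¬ G.Adj u v)
    (hr : G.MoralReach (G.An {u, v}) H u v) :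
    ∃ z ∈ (G.induce (G.An {u, v})).mb u, z ∉ H ∧
      G.MoralReach (G.An {u, v}) ((G.induce (G.An {u, v})).mb u) v z := by
  by_contra! hcon
  have hvmb := notMem_mb_pair hne hadj
  -- A walk from `v` outside `H` would never meet the Markov boundary of `u`, and so could never
  -- arrive at `u`.
  have key : ∀ x, G.MoralReach (G.An {u, v}) H v x → x ≠ u ∧
      G.MoralReach (G.An {u, v}) ((G.induce (G.An {u, v})).mb u) v x := by
    intro x hx
    induction hx with
    | base h =>
      refine ⟨?_, .base h⟩
      rintro rfl
      exact hvmb (mem_mb_pair.2 ⟨hne.symm, h⟩)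
    | @step y x _ hy hyx ih =>
      obtain ⟨hyu, hvy⟩ := ih
      have hymb : y ∉ (G.induce (G.An {u, v})).mb u := fun h => hcon y h hy hvy
      refine ⟨?_, .step hvy hymb hyx⟩
      rintro rfl
      exact hymb (mem_mb_pair.2 ⟨hyu, hyx⟩)
  exact (key u hr.symm).1 rfl

/-- If `H` is convex in the subgraph induced on `H` and any connected part of its complement in
the moral graph of `A`, then it is convex. -/
theorem moralConvex_of_components (hA : G.Ancestral A) (hAV : A ⊆ G.verts) (hHA : H ⊆ A)
    (h : ∀ z ∈ A, z ∉ H →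
      (G.induce ({x | x ∉ H ∧ G.MoralReach A H z x} ∪ H)).MoralConvex H) : G.MoralConvex H := by
  intro u hu v hv hne hr
  refine MoralAdj.adj_of_pair hne ?_
  have hBA : G.An {u, v} ⊆ A := hA.An_subset (by
    rintro _ (rfl | rfl)
    · exact hHA hu
    · exact hHA hv)
  have hB := G.ancestral_An {u, v}
  cases hr with
  | base h => exact h
  | @step z _ huz hz hzv =>
    have hzB := hzv.left_mem hB
    set C : Set V := {x | x ∉ H ∧ G.MoralReach A H z x} with hC
    have hconv := h z (hBA hzB) hz
    have hzC : z ∈ C := ⟨hz, .base (.refl (hBA hzB))⟩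
    -- Children of `C` inside `A` stay in `C ∪ H`, so every moral edge at `C` keeps its witness in
    -- the induced subgraph.
    have hmem : ∀ y ∈ C, ∀ c ∈ A, G.edge y c → c ∈ C ∪ H := by
      intro y hy c hc hyc
      by_cases hcH : c ∈ H
      · exact .inr hcH
      · exact .inl ⟨hcH, hy.2.trans hy.1 (.base (.of_edge hyc hc))⟩
    -- The ancestral closure of `{u, v}` taken in the subgraph may be smaller, as directed paths can
    -- leave `C ∪ H`. Hence the use of `MoralConvex.moralAdj`, which allows a general ancestral set.
    have hB' : (G.induce (C ∪ H)).Ancestral (G.An {u, v} ∩ (C ∪ H)) :=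
      fun x y hxy hy => ⟨hB _ _ hxy.1 hy.1, hxy.2.1⟩
    have hHV : H ⊆ (G.induce (C ∪ H)).verts := fun x hx => ⟨hAV (hHA hx), .inr hx⟩
    -- A descent from `C` stops at its first vertex of `H`, before it can leave `C ∪ H`.
    have hdesc : ∀ x ∈ G.An {u, v} ∩ (C ∪ H), ∃ t ∈ H, t ∈ G.An {u, v} ∩ (C ∪ H) ∧
        Relation.ReflTransGen (G.induce (C ∪ H)).edge x t := by
      rintro x ⟨hxB, hx⟩
      obtain ⟨w, hw, hxw⟩ := mem_An.1 hxB
      have hwH : w ∈ H := by rcases hw with rfl | rfl <;> assumption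
      induction hxw using Relation.ReflTransGen.head_induction_on with
      | refl => exact ⟨w, hwH, ⟨hxB, hx⟩, .refl⟩
      | @head x y hxy hyw ih =>
        by_cases hxH : x ∈ H
        · exact ⟨x, hxH, ⟨hxB, hx⟩, .refl⟩
        · have hyB : y ∈ G.An {u, v} := mem_An.2 ⟨w, hw, hyw⟩
          have hy := hmem x (hx.resolve_right hxH) y (hBA hyB) hxy
          obtain ⟨t, ht, htB, hyt⟩ := ih hyB hy
          exact ⟨t, ht, htB, .head ⟨hxy, hx, hy⟩ hyt⟩
    have hadj : ∀ y ∈ C, ∀ x, (x ∈ C ∨ x ∈ H) → G.MoralAdj (G.An {u, v}) y x →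
        (G.induce (C ∪ H)).MoralAdj (G.An {u, v} ∩ (C ∪ H)) y x := by
      rintro y hy x hx ⟨c, hc, hyc, hxc⟩
      have hcC : c ∈ C ∪ H := by
        rcases hyc with rfl | hyc
        · exact .inl hy
        · exact hmem y hy c (hBA hc) hyc
      exact ⟨c, ⟨hc, hcC⟩, hyc.imp id fun e => ⟨e, .inl hy, hcC⟩,
        hxc.imp id fun e => ⟨e, hx, hcC⟩⟩
    have hin : ∀ x, G.MoralReach A H z x → x ∈ C ∨ x ∈ H := fun x hx => by
      by_cases hxH : x ∈ H
      · exact .inr hxH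
      · exact .inl ⟨hxH, hx⟩
    have hreach : ∀ x, G.MoralReach (G.An {u, v}) H z x →
        (G.induce (C ∪ H)).MoralReach (G.An {u, v} ∩ (C ∪ H)) H z x := by
      intro x hx
      induction hx with
      | base h => exact .base (hadj z hzC _ (hin _ (.base (h.mono hBA))) h)
      | @step y x h1 h2 h3 ih =>
        have h1' := h1.mono hBA
        exact .step ih h2 (hadj y ⟨h2, h1'⟩ x (hin x (.step h1' h2 (h3.mono hBA))) h3)
    obtain ⟨c, hc, h1, h2⟩ := hconv.moralAdj hHV hB' hdesc hu hv
      ((hreach u huz.symm).symm.trans hz (hreach v (.base hzv)))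
    exact ⟨c, hc.1, h1.imp id fun e => e.1, h2.imp id fun e => e.1⟩

end Convex

/-! ### Active walks, and paths obtained from moral walks -/

section Paths

/-- The vertices of `W` that have both neighbours on the walk `l` are colliders of `l`. -/
def Active (G : FinDAG V) (W : Set V) : List V → Prop
  | [] => True
  | [_] => True
  | [_, _] => True
  | a :: b :: c :: l => (b ∈ W → G.edge a b ∧ G.edge c b) ∧ G.Active W (b :: c :: l)

variable {G : FinDAG V} {A W : Set V}

theorem Active.tail {a : V} {l : List V} (h : G.Active W (a :: l)) : G.Active W l := by
  match l, h with
  | [], _ => trivial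
  | [_], _ => trivial
  | _ :: _ :: _, h => exact h.2

theorem Active.of_append {l l' : List V} (h : G.Active W (l ++ l')) : G.Active W l' := by
  induction l with
  | nil => exact h
  | cons a l ih => exact ih h.tail

theorem Active.edge_of_append {a b c : V} {l l' : List V}
    (h : G.Active W (l ++ a :: b :: c :: l')) (hb : b ∈ W) : G.edge a b ∧ G.edge c b :=
  h.of_append.1 hb

/-- If `w ∈ W` remains intermediate, both occurrences were colliders. The edge entering the first
and the edge leaving the second thus both point into `w`, which is still a collider after the loop
is cut out. -/
theorem Active.shortcut {w : V} {l₁ l₂ l₃ : List V}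
    (h : G.Active W (l₁ ++ w :: l₂ ++ w :: l₃)) : G.Active W (l₁ ++ w :: l₃) := by
  have h3 : G.Active W (w :: l₃) := h.of_append
  match l₁, h with
  | [], _ => exact h3
  | [a], h =>
    match l₃, h, h3 with
    | [], _, _ => trivial
    | c :: l, h, h3 =>
      refine ⟨fun hw => ⟨?_, ?_⟩, h3⟩
      · match l₂, h with
        | [], h => exact (h.1 hw).1
        | _ :: _, h => exact (h.1 hw).1
      · have h' : G.Active W (([a] ++ w :: l₂) ++ w :: c :: l) := h
        rcases List.eq_nil_or_concat (w :: l₂) with h0 | ⟨L, d, h0⟩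
        · cases h0
        · rw [h0] at h'
          have h'' : G.Active W (([a] ++ L) ++ d :: w :: c :: l) := by simpa using h'
          exact (h''.edge_of_append hw).2
  | [a, b], h => exact ⟨h.1, Active.shortcut (l₁ := [b]) (l₂ := l₂) h.2⟩
  | a :: b :: c :: l, h => exact ⟨h.1, Active.shortcut (l₁ := b :: c :: l) (l₂ := l₂) h.2⟩

theorem exists_split_of_not_nodup {l : List V} (h : ¬ l.Nodup) :
    ∃ w l₁ l₂ l₃, l = l₁ ++ w :: l₂ ++ w :: l₃ := by
  induction l with
  | nil => exact absurd List.nodup_nil h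
  | cons a l ih =>
    by_cases ha : a ∈ l
    · obtain ⟨s, t, rfl⟩ := List.append_of_mem ha
      exact ⟨a, [], s, t, rfl⟩
    · obtain ⟨w, l₁, l₂, l₃, rfl⟩ := ih fun hl => h (List.nodup_cons.2 ⟨ha, hl⟩)
      exact ⟨w, a :: l₁, l₂, l₃, rfl⟩

/-- An active walk can be shortened to an active path. -/
theorem exists_nodup_of_active (G : FinDAG V) (W : Set V) {x y : V} (l : List V)
    (hx : l.head? = some x) (hy : l.getLast? = some y) (hc : l.IsChain G.Adj)
    (ha : G.Active W l) :
    ∃ l' : List V, l'.head? = some x ∧ l'.getLast? = some y ∧ l'.IsChain G.Adj ∧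
      G.Active W l' ∧ l'.Nodup := by
  by_cases hn : l.Nodup
  · exact ⟨l, hx, hy, hc, ha, hn⟩
  · obtain ⟨w, l₁, l₂, l₃, hl⟩ := exists_split_of_not_nodup hn
    rw [hl] at hx hy hc ha
    refine exists_nodup_of_active G W (l₁ ++ w :: l₃) ?_ ?_ ?_ ha.shortcut
    · cases l₁ <;> simpa using hx
    · rw [List.getLast?_append_of_ne_nil _ (by simp)] at hy ⊢
      exact hy
    · have h1 : (l₁ ++ ([w] ++ (l₂ ++ w :: l₃))).IsChain G.Adj := by simpa using hc
      have h2 : ((l₁ ++ w :: l₂) ++ w :: l₃).IsChain G.Adj := by simpa using hc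
      rw [List.isChain_append] at h1 h2 ⊢
      refine ⟨h1.1, h2.2.1, fun a ha b hb => h1.2.2 a ha b (by simpa using hb)⟩
termination_by l.length
decreasing_by simp [hl]

/-- A walk in the moral graph of an ancestral set gives an active walk in the graph. -/
theorem MoralReach.exists_active (hA : G.Ancestral A) {x y : V} (h : G.MoralReach A W x y) :
    ∃ l : List V, l.head? = some y ∧ l.getLast? = some x ∧ l.IsChain (G.induce A).Adj ∧
      (G.induce A).Active W l := by
  have hin : ∀ {a b : V}, G.edge a b → b ∈ A → (G.induce A).edge a b :=
    fun h1 h2 => (induce_edge hA).2 ⟨h1, h2⟩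
  induction h with
  | @base y h =>
    obtain ⟨c, hc, rfl | h1, rfl | h2⟩ := h
    · exact ⟨[_], rfl, rfl, by simp, trivial⟩
    · exact ⟨[y, x], rfl, rfl, by simp [Adj, hin h2 hc], trivial⟩
    · exact ⟨[y, x], rfl, rfl, by simp [Adj, hin h1 hc], trivial⟩
    · exact ⟨[y, c, x], rfl, rfl, by simp [Adj, hin h1 hc, hin h2 hc],
        fun _ => ⟨hin h2 hc, hin h1 hc⟩, trivial⟩
  | @step y z _ hy h ih =>
    obtain ⟨l, h1, h2, h3, h4⟩ := ih
    match l, h1 with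
    | y :: l, rfl =>
      have hcons : ∀ c, (G.induce A).Active W (c :: y :: l) := by
        intro c
        cases l with
        | nil => trivial
        | cons d l => exact ⟨fun h => absurd h hy, h4⟩
      obtain ⟨c, hc, rfl | e1, rfl | e2⟩ := h
      · exact ⟨_, rfl, h2, h3, h4⟩
      · exact ⟨z :: y :: l, rfl, by simpa using h2,
          List.isChain_cons_cons.2 ⟨.inl (hin e2 hc), h3⟩, hcons z⟩
      · exact ⟨z :: y :: l, rfl, by simpa using h2,
          List.isChain_cons_cons.2 ⟨.inr (hin e1 hc), h3⟩, hcons z⟩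
      · exact ⟨z :: c :: y :: l, rfl, by simpa using h2,
          List.isChain_cons_cons.2 ⟨.inl (hin e2 hc),
            List.isChain_cons_cons.2 ⟨.inr (hin e1 hc), h3⟩⟩,
          fun _ => ⟨hin e2 hc, hin e1 hc⟩, hcons c⟩

theorem Active.inter_pathInner_subset {x y : V} {l : List V} (h : G.Active W l)
    (hx : l.head? = some x) (hy : l.getLast? = some y) :
    W ∩ pathInner x y l ⊆ G.colliders l := by
  rintro w ⟨hwW, hwl, hwxy⟩
  simp only [Set.mem_insert_iff, Set.mem_singleton_iff, not_or] at hwxy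
  obtain ⟨s, t, rfl⟩ := List.append_of_mem hwl
  rcases List.eq_nil_or_concat s with rfl | ⟨s, a, rfl⟩
  · simp at hx
    exact absurd hx hwxy.1
  match t, hy, h with
  | [], hy, _ =>
    simp at hy
    exact absurd hy hwxy.2
  | b :: t, _, h =>
    have h' : G.Active W (s ++ a :: w :: b :: t) := by simpa using h
    exact ⟨a, b, ⟨s, t, by simp⟩, h'.edge_of_append hwW⟩

theorem mem_of_isChain {x y : V} (l : List V) (hx : l.head? = some x) (hxv : x ∈ G.verts)
    (hc : l.IsChain G.Adj) (hy : y ∈ l) : y ∈ G.verts := by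
  induction l generalizing x with
  | nil => cases hx
  | cons a l ih =>
    obtain rfl : a = x := by simpa using hx
    rcases List.mem_cons.1 hy with rfl | hy
    · exact hxv
    cases l with
    | nil => cases hy
    | cons b l =>
      rw [List.isChain_cons_cons] at hc
      refine ih rfl ?_ hc.2 hy
      rcases hc.1 with h | h
      · exact (G.edge_mem _ _ h).2
      · exact (G.edge_mem _ _ h).1

/-- A walk in the moral graph of an ancestral set gives a path in the induced subgraph whose
intermediate vertices in `W` are colliders. -/
theorem MoralReach.exists_isPath (hA : G.Ancestral A) (hAV : A ⊆ G.verts) {x y : V}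
    (h : G.MoralReach A W x y) :
    ∃ l, (G.induce A).IsPath x y l ∧ W ∩ pathInner x y l ⊆ (G.induce A).colliders l := by
  obtain ⟨l, h1, h2, h3, h4⟩ := h.symm.exists_active hA
  obtain ⟨l, h1, h2, h3, h4, h5⟩ := exists_nodup_of_active _ W l h1 h2 h3 h4
  have hxA : x ∈ A := h.symm.right_mem hA
  exact ⟨l, ⟨h1, h2, h5, h3, fun w hw => mem_of_isChain l h1 ⟨hAV hxA, hxA⟩ h3 hw⟩,
    h4.inter_pathInner_subset h1 h2⟩

end Paths

/-! ### From paths to moral walks, and the translation of inducing paths, separators and components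
-/

section Paths

variable {G : FinDAG V} {A W H : Set V} {x y u v : V}

theorem active_of_forall {l : List V}
    (h : ∀ s a b c t, l = s ++ a :: b :: c :: t → b ∈ W → G.edge a b ∧ G.edge c b) :
    G.Active W l := by
  match l, h with
  | [], _ => trivial
  | [_], _ => trivial
  | [_, _], _ => trivial
  | a :: b :: c :: l, h =>
    refine ⟨h [] a b c l rfl, active_of_forall fun s a' b' c' t e => ?_⟩
    exact h (a :: s) a' b' c' t (by rw [e]; rfl)

theorem IsPath.mem_pathInner {l s t : List V} {a b c : V} (hl : G.IsPath x y l)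
    (h : l = s ++ a :: b :: c :: t) : b ∈ pathInner x y l := by
  obtain ⟨h1, h2, h3, -, -⟩ := hl
  subst h
  refine ⟨by simp, ?_⟩
  have h3' : ((s ++ [a]) ++ b :: c :: t).Nodup := by simpa using h3
  have hb := List.nodup_middle.1 h3'
  rw [List.nodup_cons] at hb
  rintro (rfl | rfl)
  · apply hb.1
    cases s with
    | nil => simp at h1; simp [h1]
    | cons d s => simp at h1; simp [h1]
  · apply hb.1
    have h2' : ((s ++ [a, b]) ++ c :: t).getLast? = some b := by simpa using h2
    rw [List.getLast?_append_of_ne_nil _ (by simp)] at h2'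
    have := List.mem_of_getLast? h2'
    simp only [List.mem_append]
    exact .inr this

theorem IsPath.colliders_subset {l : List V} (hl : G.IsPath x y l) :
    G.colliders l ⊆ pathInner x y l := by
  rintro b ⟨a, c, ⟨s, t, h⟩, -, -⟩
  exact hl.mem_pathInner (s := s) (a := a) (c := c) (t := t) (by rw [← h]; simp)

/-- A vertex occurs only once on a path, so the neighbours that make it a collider are its
neighbours at the given position. -/
theorem IsPath.active {l : List V} (hl : G.IsPath x y l)
    (h : W ∩ pathInner x y l ⊆ G.colliders l) : G.Active W l := by
  refine active_of_forall fun s a b c t e hb => ?_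
  obtain ⟨a', c', ⟨s', t', e'⟩, h1, h2⟩ := h ⟨hb, hl.mem_pathInner e⟩
  have hn := hl.2.2.1
  have e2 : (s ++ [a]) ++ b :: ([c] ++ t) = (s' ++ [a']) ++ b :: ([c'] ++ t') := by
    simpa using e.symm.trans e'.symm
  rw [e, show s ++ a :: b :: c :: t = (s ++ [a]) ++ b :: ([c] ++ t) by simp] at hn
  have hn := (List.nodup_cons.1 (List.nodup_middle.1 hn)).1
  rw [List.mem_append, not_or] at hn
  obtain ⟨e3, -, e4⟩ := (List.append_cons_inj_of_notMem hn.1 hn.2).1 e2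
  obtain rfl : a = a' := by
    have := congrArg List.getLast? e3
    simpa using this
  obtain rfl : c = c' := by
    have := congrArg List.head? e4
    simpa using this
  exact ⟨h1, h2⟩

/-- Each collider in `W` is skipped by the moral edge between its two neighbours. -/
theorem MoralReach.of_active {x : V} (l : List V) (hx : l.head? = some x) (hy : l.getLast? = some y)
    (hc : l.IsChain G.Adj) (ha : G.Active W l) (hlA : ∀ w ∈ l, w ∈ A) :
    G.MoralReach A W x y := by
  have hadj : ∀ {a b : V}, G.Adj a b → a ∈ A → b ∈ A → G.MoralAdj A a b := by
    rintro a b (h | h) h1 h2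
    · exact .of_edge h h2
    · exact (MoralAdj.of_edge h h1).symm
  match l, hx with
  | [x], rfl =>
    obtain rfl : x = y := by simpa using hy
    exact .base (.refl (hlA x (by simp)))
  | [x, b], rfl =>
    obtain rfl : b = y := by simpa using hy
    exact .base (hadj (by simpa using hc) (hlA _ (by simp)) (hlA _ (by simp)))
  | x :: b :: c :: l, rfl =>
    rw [List.isChain_cons_cons] at hc
    by_cases hb : b ∈ W
    · obtain ⟨e1, e2⟩ := ha.1 hb
      have hxc : G.MoralAdj A x c := ⟨b, hlA _ (by simp), .inr e1, .inr e2⟩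
      match l, hy, hc, ha, hlA with
      | [], hy, _, _, _ =>
        obtain rfl : c = y := by simpa using hy
        exact .base hxc
      | d :: l, hy, hc, ha, hlA =>
        -- Consecutive vertices cannot both be colliders, since the edge between them has one
        -- direction.
        have hcW : c ∉ W := fun hcW => G.edge_asymm e2 (ha.2.1 hcW).1
        refine .head hxc hcW (MoralReach.of_active (c :: d :: l) rfl (by simpa using hy)
          (List.isChain_cons_cons.1 hc.2).2 ha.2.2 fun w hw => hlA w ?_)
        simp only [List.mem_cons] at hw ⊢
        tauto
    · exact .head (hadj hc.1 (hlA _ (by simp)) (hlA _ (by simp))) hb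
        (MoralReach.of_active (b :: c :: l) rfl (by simpa using hy) hc.2 ha.2
          fun w hw => hlA w (List.mem_cons_of_mem _ hw))

theorem IsPath.moralReach {l : List V} (hl : G.IsPath x y l)
    (h : W ∩ pathInner x y l ⊆ G.colliders l) (hlA : ∀ w ∈ l, w ∈ A) : G.MoralReach A W x y :=
  .of_active l hl.1 hl.2.1 hl.2.2.2.1 (hl.active h) hlA

theorem colliders_induce_subset (l : List V) : (G.induce A).colliders l ⊆ G.colliders l :=
  fun _ ⟨a, c, h, h1, h2⟩ => ⟨a, c, h, h1.1, h2.1⟩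

theorem adj_of_induce (h : (G.induce A).Adj x y) : G.Adj x y := h.imp And.left And.left

theorem IsPath.of_induce {l : List V} (hl : (G.induce A).IsPath x y l) : G.IsPath x y l :=
  ⟨hl.1, hl.2.1, hl.2.2.1, hl.2.2.2.1.imp fun _ _ => adj_of_induce,
    fun w hw => (hl.2.2.2.2 w hw).1⟩

theorem IsPath.moralReach_of_induce {l : List V} (hl : (G.induce A).IsPath x y l)
    (h : W ∩ pathInner x y l ⊆ (G.induce A).colliders l) : G.MoralReach A W x y :=
  hl.of_induce.moralReach (h.trans (colliders_induce_subset l)) fun w hw => (hl.2.2.2.2 w hw).2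

/-- A walk whose colliders and ends lie in an ancestral set lies in this set. -/
theorem forall_mem_of_colliders_subset (hA : G.Ancestral A) (l : List V)
    (hx : ∀ a b t, l = a :: b :: t → G.edge b a → a ∈ A) (hy : ∀ a, l.getLast? = some a → a ∈ A)
    (hc : l.IsChain G.Adj) (hcol : G.colliders l ⊆ A) : ∀ w ∈ l, w ∈ A := by
  match l with
  | [] => simp
  | [a] => simpa using hy
  | a :: b :: t =>
    rw [List.isChain_cons_cons] at hc
    -- The condition `hx` passes to the tail: if the next edge points into `b`, then `b` is either a
    -- collider or a parent of `a`, and in that second case `hx` applies to `a`.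
    have ih : ∀ w ∈ b :: t, w ∈ A := by
      refine forall_mem_of_colliders_subset hA (b :: t) ?_ (by simpa using hy) hc.2 ?_
      · rintro b' c t' e hcb
        obtain ⟨rfl, rfl⟩ := List.cons_eq_cons.1 e
        rcases hc.1 with hab | hba
        · exact hcol ⟨a, c, ⟨[], t', rfl⟩, hab, hcb⟩
        · exact hA _ _ hba (hx a b _ rfl hba)
      · rintro w ⟨p, q, h, h1⟩
        exact hcol ⟨p, q, List.infix_cons h, h1⟩
    intro w hw
    rcases List.mem_cons.1 hw with rfl | hw
    · rcases hc.1 with h | h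
      · exact hA _ _ h (ih b (by simp))
      · exact hx w b t rfl h
    · exact ih w hw

theorem IsInducingPath.moralReach {l : List V} (h : G.IsInducingPath H u v l) :
    G.MoralReach (G.An {u, v}) H u v := by
  obtain ⟨-, -, -, -, hl, h1, h2⟩ := h
  refine hl.moralReach h1 (forall_mem_of_colliders_subset (G.ancestral_An _) l ?_ ?_ hl.2.2.2.1
    (h2.trans Set.sdiff_subset))
  · rintro a b t rfl -
    have := hl.1
    simp at this
    exact G.subset_An _ (by simp [this])
  · intro a ha
    rw [hl.2.1] at ha
    cases ha
    exact G.subset_An _ (by simp)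

theorem An_pair_subset_verts (hH : H ⊆ G.verts) (hu : u ∈ H) (hv : v ∈ H) :
    G.An {u, v} ⊆ G.verts :=
  G.ancestral_verts.An_subset (by
    rintro _ (rfl | rfl)
    exacts [hH hu, hH hv])

theorem MoralReach.exists_isInducingPath (hH : H ⊆ G.verts) (hu : u ∈ H) (hv : v ∈ H)
    (hne : u ≠ v) (hadj : ¬ G.Adj u v) (h : G.MoralReach (G.An {u, v}) H u v) :
    ∃ l, G.IsInducingPath H u v l := by
  obtain ⟨l, hl, h1⟩ := h.exists_isPath (G.ancestral_An _) (An_pair_subset_verts hH hu hv)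
  refine ⟨l, hu, hv, hne, hadj, hl.of_induce, h1.trans (colliders_induce_subset l), fun w hw => ?_⟩
  have := hl.of_induce.colliders_subset hw
  -- The whole path lies in `An {u, v}`, and a collider is intermediate, hence differs from both
  -- ends.
  exact ⟨(hl.2.2.2.2 w this.1).2, this.2⟩

/-- A set of vertices has no inducing path if and only if it is convex in the sense of moral
graphs. -/
theorem moralConvex_iff (hH : H ⊆ G.verts) :
    G.MoralConvex H ↔ ¬ ∃ u v l, G.IsInducingPath H u v l := by
  constructor
  · rintro h ⟨u, v, l, hl⟩
    exact hl.2.2.2.1 (h u hl.1 v hl.2.1 hl.2.2.1 hl.moralReach)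
  · intro h u hu v hv hne hr
    by_contra hadj
    obtain ⟨l, hl⟩ := hr.exists_isInducingPath hH hu hv hne hadj
    exact h ⟨u, v, l, hl⟩

theorem iPairs_eq_empty_iff (hH : H ⊆ G.verts) : G.iPairs H = ∅ ↔ G.MoralConvex H := by
  rw [moralConvex_iff hH, Set.eq_empty_iff_forall_notMem]
  constructor
  · rintro h ⟨u, v, l, hl⟩
    exact h _ ⟨u, v, l, rfl, hl⟩
  · rintro h p ⟨u, v, l, rfl, hl⟩
    exact h ⟨u, v, l, hl⟩

theorem mem_fcmds_iff (hV : G.An {u, v} ⊆ G.verts) {z : V} :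
    z ∈ G.fcmds u v ↔ z ∈ (G.induce (G.An {u, v})).mb u ∧
      G.MoralReach (G.An {u, v}) ((G.induce (G.An {u, v})).mb u) v z :=
  and_congr_right fun _ =>
    ⟨fun ⟨_, hl, h⟩ => hl.moralReach_of_induce h, fun h => h.exists_isPath (G.ancestral_An _) hV⟩

theorem fcmds_subset_An : G.fcmds u v ⊆ G.An {u, v} := by
  rintro z ⟨-, l, hl, -⟩
  exact (hl.2.2.2.2 z (List.mem_of_getLast? hl.2.1)).2

theorem MoralConvex.fcmds_subset (h : G.MoralConvex H) (hH : H ⊆ G.verts) (hu : u ∈ H)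
    (hv : v ∈ H) (hne : u ≠ v) (hadj : ¬ G.Adj u v) : G.fcmds u v ⊆ H := fun z hz => by
  obtain ⟨h1, h2⟩ := (mem_fcmds_iff (An_pair_subset_verts hH hu hv)).1 hz
  exact h.mem_of_moralReach hH hu hv hne hadj h1 h2

theorem IsInducingPath.not_fcmds_subset (hH : H ⊆ G.verts) {l : List V}
    (h : G.IsInducingPath H u v l) : ¬ G.fcmds u v ⊆ H := fun hs => by
  obtain ⟨z, h1, h2, h3⟩ := exists_mb_of_moralReach h.2.2.1 h.2.2.2.1 h.moralReach
  exact h2 (hs ((mem_fcmds_iff (An_pair_subset_verts hH h.1 h.2.1)).2 ⟨h1, h3⟩))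

/-- The connected classes of the complement of `H` in the moral graph of an ancestral set are
d-connected components. -/
theorem isDComponent_moralReach (hA : G.Ancestral A) (hAV : A ⊆ G.verts) {z : V} (hzA : z ∈ A)
    (hz : z ∉ H) : (G.induce A).IsDComponent H {x | x ∉ H ∧ G.MoralReach A H z x} := by
  refine ⟨⟨fun x hx => ?_, fun x hx y hy _ => ?_⟩, fun M hM hMc => hM.2 fun m hm => ?_⟩
  · have := hx.2.right_mem hA
    exact ⟨⟨hAV this, this⟩, hx.1⟩
  · obtain ⟨l, hl, h⟩ := (hx.2.symm.trans hz hy.2).exists_isPath hA hAV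
    exact ⟨l, hl, Set.inter_comm _ _ ▸ h⟩
  · have hzz : G.MoralReach A H z z := .base (.refl hzA)
    refine ⟨(hMc.1 hm).2, ?_⟩
    by_cases hzm : z = m
    · exact hzm ▸ hzz
    · obtain ⟨l, hl, h⟩ := hMc.2 z (hM.1 ⟨hz, hzz⟩) m hm hzm
      exact hl.moralReach_of_induce (Set.inter_comm _ _ ▸ h)

end Paths

/-! ### Invariants, termination and correctness of CMDSA -/

section Algorithm

variable {G : FinDAG V} {B R H H' T : Set V} {u v : V} {p : Sym2 V}

theorem An_induce_subset (S : Set V) : (G.induce B).An S ⊆ G.An S := fun x hx => by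
  obtain ⟨w, hw, h⟩ := mem_An.1 hx
  exact mem_An.2 ⟨w, hw, Relation.ReflTransGen.mono (fun _ _ e => e.1) _ _ h⟩

theorem IsInducingPath.of_induce (hHB : H ⊆ B) {l : List V}
    (h : (G.induce B).IsInducingPath H u v l) : G.IsInducingPath H u v l := by
  obtain ⟨hu, hv, hne, hadj, hl, h1, h2⟩ := h
  refine ⟨hu, hv, hne, fun h => hadj ?_, hl.of_induce, h1.trans (colliders_induce_subset l),
    fun w hw => ?_⟩
  · exact h.imp (fun e => ⟨e, hHB hu, hHB hv⟩) fun e => ⟨e, hHB hv, hHB hu⟩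
  · have := hl.of_induce.colliders_subset hw
    refine ⟨?_, this.2⟩
    refine forall_mem_of_colliders_subset (G := G.induce B)
      (A := (G.induce B).An {u, v}) ((G.induce B).ancestral_An _) l ?_ ?_ hl.2.2.2.1
      (h2.trans Set.sdiff_subset) w this.1 |> fun h => An_induce_subset _ h
    · rintro a b t rfl -
      have := hl.1
      simp at this
      exact subset_An _ _ (by simp [this])
    · intro a ha
      rw [hl.2.1] at ha
      cases ha
      exact subset_An _ _ (by simp)

theorem exists_of_mem_iPairs_induce {M : Set V} (h : p ∈ (G.induce (M ∪ H)).iPairs H) :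
    ∃ u v l, p = s(u, v) ∧ G.IsInducingPath H u v l := by
  obtain ⟨u, v, l, rfl, hl⟩ := h
  exact ⟨u, v, l, rfl, hl.of_induce Set.subset_union_right⟩

theorem MoralConvex.closeSeparators_subset (hT : G.MoralConvex T) (hTV : T ⊆ G.verts)
    (hHT : H ⊆ T) {M : Set V} (h : p ∈ (G.induce (M ∪ H)).iPairs H) :
    G.closeSeparators p ⊆ T := by
  obtain ⟨u, v, l, rfl, hu, hv, hne, hadj, -⟩ := exists_of_mem_iPairs_induce h
  exact Set.union_subset (hT.fcmds_subset hTV (hHT hu) (hHT hv) hne hadj)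
    (hT.fcmds_subset hTV (hHT hv) (hHT hu) hne.symm fun h => hadj h.symm)

/-- Used with `T = An(R)`, to keep `H` inside the graph whose components are enumerated, and with `T
= G.verts`. -/
theorem Ancestral.closeSeparators_subset (hT : G.Ancestral T) (hHT : H ⊆ T) {M : Set V}
    (h : p ∈ (G.induce (M ∪ H)).iPairs H) : G.closeSeparators p ⊆ T := by
  obtain ⟨u, v, l, rfl, hu, hv, -⟩ := exists_of_mem_iPairs_induce h
  refine Set.union_subset (fcmds_subset_An.trans (hT.An_subset ?_))
    (fcmds_subset_An.trans (hT.An_subset ?_)) <;> rintro _ (rfl | rfl) <;> apply hHT <;> assumption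

theorem mem_absorb {Q : List (Sym2 V)} {x : V} :
    x ∈ G.absorb Q H ↔ x ∈ H ∨ ∃ p ∈ Q, x ∈ G.closeSeparators p := by
  unfold absorb
  induction Q generalizing H with
  | nil => simp
  | cons p Q ih => simp [ih, or_assoc]

theorem subset_absorb (Q : List (Sym2 V)) : H ⊆ G.absorb Q H := fun _ h => mem_absorb.2 (.inl h)

theorem ComponentLoop.subset {Ms : List (Set V)} (h : G.ComponentLoop Ms H H') : H ⊆ H' := by
  induction h with
  | nil H => exact subset_rfl
  | cons M Ms H H' Q _ _ _ ih => exact (subset_absorb Q).trans ih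

theorem absorb_subset {Q : List (Sym2 V)} {M : Set V}
    (hT : ∀ H ⊆ T, ∀ M p, p ∈ (G.induce (M ∪ H)).iPairs H → G.closeSeparators p ⊆ T)
    (hH : H ⊆ T) (hQ : ∀ p, p ∈ Q ↔ p ∈ (G.induce (M ∪ H)).iPairs H) : G.absorb Q H ⊆ T := by
  intro x hx
  rcases mem_absorb.1 hx with hx | ⟨p, hp, hx⟩
  · exact hH hx
  · exact hT H hH M p ((hQ p).1 hp) hx

/-- Serves both invariants of a pass: ancestral supersets and convex supersets. -/
theorem ComponentLoop.subset_of_closed {Ms : List (Set V)} (h : G.ComponentLoop Ms H H')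
    (hT : ∀ H ⊆ T, ∀ M p, p ∈ (G.induce (M ∪ H)).iPairs H → G.closeSeparators p ⊆ T)
    (hH : H ⊆ T) : H' ⊆ T := by
  induction h with
  | nil H => exact hH
  | cons M Ms H H' Q _ hQ _ ih => exact ih (absorb_subset hT hH hQ)

/-- If nothing is added in the end, nothing was added in between, so every component was examined
with the same `H`. -/
theorem ComponentLoop.closeSeparators_subset {Ms : List (Set V)} (h : G.ComponentLoop Ms H H')
    (hH : H' ⊆ H) {M : Set V} (hM : M ∈ Ms) (hp : p ∈ (G.induce (M ∪ H)).iPairs H) :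
    G.closeSeparators p ⊆ H := by
  induction h with
  | nil H => cases hM
  | cons N Ms H H' Q _ hQ hl ih =>
    have hQH : G.absorb Q H = H := (hl.subset.trans hH).antisymm (subset_absorb Q)
    rw [hQH] at ih
    rcases List.mem_cons.1 hM with rfl | hM
    · intro x hx
      rw [← hQH]
      exact mem_absorb.2 (.inr ⟨p, (hQ p).2 hp, hx⟩)
    · exact ih hH hM hp

theorem finite_iPairs (G : FinDAG V) {H : Set V} (hH : H ⊆ G.verts) : (G.iPairs H).Finite := by
  have hf := G.finite_verts.subset hH
  refine ((hf.prod hf).image fun q : V × V => s(q.1, q.2)).subset ?_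
  rintro p ⟨u, v, l, rfl, hu, hv, -⟩
  exact ⟨(u, v), ⟨hu, hv⟩, rfl⟩

theorem exists_list_of_finite {α : Type*} {s : Set α} (hs : s.Finite) :
    ∃ l : List α, l.Nodup ∧ ∀ a, a ∈ l ↔ a ∈ s :=
  ⟨hs.toFinset.toList, Finset.nodup_toList _, fun a => by simp⟩

theorem exists_componentLoop (Ms : List (Set V)) (hH : H ⊆ G.verts) :
    ∃ H', G.ComponentLoop Ms H H' := by
  induction Ms generalizing H with
  | nil => exact ⟨H, .nil H⟩
  | cons M Ms ih =>
    have hHM : H ⊆ (G.induce (M ∪ H)).verts := fun x hx => ⟨hH hx, .inr hx⟩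
    obtain ⟨Q, hQ, hQ'⟩ := exists_list_of_finite (finite_iPairs _ hHM)
    obtain ⟨H', h⟩ := ih (absorb_subset
      (fun H hH M p hp => G.ancestral_verts.closeSeparators_subset hH hp) hH hQ')
    exact ⟨H', .cons M Ms H H' Q hQ hQ' h⟩

theorem exists_CMDSAPass (G : FinDAG V) (R : Set V) (hH : H ⊆ G.verts) :
    ∃ H', G.CMDSAPass R H H' := by
  have hf : {M | (G.induce (G.An R)).IsDComponent H M}.Finite :=
    G.finite_verts.finite_subsets.subset fun M hM x hx => (hM.1.1 hx).1.1
  obtain ⟨Ms, hn, hMs⟩ := exists_list_of_finite hf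
  obtain ⟨H', h⟩ := exists_componentLoop Ms hH
  exact ⟨H', Ms, hn, hMs, h⟩

theorem CMDSAPass.subset (h : G.CMDSAPass R H H') : H ⊆ H' := by
  obtain ⟨Ms, -, -, h⟩ := h
  exact h.subset

theorem CMDSAPass.subset_of_ancestral (h : G.CMDSAPass R H H') (hT : G.Ancestral T)
    (hH : H ⊆ T) : H' ⊆ T := by
  obtain ⟨Ms, -, -, h⟩ := h
  exact h.subset_of_closed (fun H hH M p hp => hT.closeSeparators_subset hH hp) hH

theorem CMDSAPass.subset_of_moralConvex (h : G.CMDSAPass R H H') (hT : G.MoralConvex T)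
    (hTV : T ⊆ G.verts) (hH : H ⊆ T) : H' ⊆ T := by
  obtain ⟨Ms, -, -, h⟩ := h
  exact h.subset_of_closed (fun H hH M p hp => hT.closeSeparators_subset hTV hH hp) hH

/-- A pass that does not enlarge `H` shows that `H` is convex. -/
theorem CMDSAPass.moralConvex (hR : R ⊆ G.verts) (hHR : H ⊆ G.An R)
    (h : G.CMDSAPass R H H') (hH : H' ⊆ H) : G.MoralConvex H := by
  obtain ⟨Ms, -, hMs, h⟩ := h
  have hRV : G.An R ⊆ G.verts := G.ancestral_verts.An_subset hR
  refine moralConvex_of_components (G.ancestral_An R) hRV hHR fun z hzA hz => ?_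
  have hM := (hMs _).2 (isDComponent_moralReach (G.ancestral_An R) hRV hzA hz)
  refine (moralConvex_iff (show H ⊆ (G.induce (_ ∪ H)).verts from
    fun x hx => ⟨hRV (hHR hx), .inr hx⟩)).2 ?_
  rintro ⟨u, v, l, hl⟩
  -- The pass has already absorbed the separators of this pair into `H`, yet an inducing path forces
  -- one of their vertices outside `H`.
  have hs := h.closeSeparators_subset hH hM ⟨u, v, l, rfl, hl⟩
  exact (hl.of_induce Set.subset_union_right).not_fcmds_subset (hHR.trans hRV)
    (Set.subset_union_left.trans hs)

theorem CMDSAPass.ssubset (hR : R ⊆ G.verts) (hHR : H ⊆ G.An R) (h : G.CMDSAPass R H H')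
    (hi : G.iPairs H' ≠ ∅) : H ⊂ H' := by
  refine ⟨h.subset, fun hH => hi ?_⟩
  have := hH.antisymm h.subset
  subst this
  exact (iPairs_eq_empty_iff (hHR.trans (G.ancestral_verts.An_subset hR))).2
    (h.moralConvex hR hHR subset_rfl)

theorem exists_CMDSALoop (hR : R ⊆ G.verts) (H : Set V) (hHR : H ⊆ G.An R) :
    ∃ H', G.CMDSALoop R H H' := by
  have hRV : G.An R ⊆ G.verts := G.ancestral_verts.An_subset hR
  obtain ⟨H', h⟩ := exists_CMDSAPass G R (hHR.trans hRV)
  by_cases hi : G.iPairs H' = ∅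
  · exact ⟨H', .finish H H' h hi⟩
  · have hHR' := h.subset_of_ancestral (G.ancestral_An R) hHR
    -- The number of vertices not yet absorbed is the termination measure.
    have hlt : (G.verts \ H').ncard < (G.verts \ H).ncard := by
      have hss := h.ssubset hR hHR hi
      refine Set.ncard_lt_ncard ⟨Set.sdiff_subset_sdiff_right hss.1, fun hle => hss.2 ?_⟩
        (G.finite_verts.subset Set.sdiff_subset)
      intro x hx
      by_contra hxH
      exact (hle ⟨hRV (hHR' hx), hxH⟩).2 hx
    obtain ⟨H'', h'⟩ := exists_CMDSALoop hR H' hHR'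
    exact ⟨H'', .again H H' H'' h hi h'⟩
termination_by (G.verts \ H).ncard

theorem CMDSALoop.spec (h : G.CMDSALoop R H H') (hR : R ⊆ G.verts) (hHR : H ⊆ G.An R) :
    H ⊆ H' ∧ H' ⊆ G.verts ∧ G.MoralConvex H' ∧
      ∀ T, G.MoralConvex T → T ⊆ G.verts → H ⊆ T → H' ⊆ T := by
  have hRV : G.An R ⊆ G.verts := G.ancestral_verts.An_subset hR
  induction h with
  | finish H H' h hi =>
    have hV := (h.subset_of_ancestral (G.ancestral_An R) hHR).trans hRV
    exact ⟨h.subset, hV, (iPairs_eq_empty_iff hV).1 hi,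
      fun T hT hTV hH => h.subset_of_moralConvex hT hTV hH⟩
  | again H H' H'' h _ _ ih =>
    obtain ⟨h1, h2, h3, h4⟩ := ih (h.subset_of_ancestral (G.ancestral_An R) hHR)
    exact ⟨h.subset.trans h1, h2, h3,
      fun T hT hTV hH => h4 T hT hTV (h.subset_of_moralConvex hT hTV hH)⟩

/-- An infinite run would be a strictly increasing sequence of subsets of a finite set. -/
theorem not_CMDSADiverges (hR : R ⊆ G.verts) : ¬ G.CMDSADiverges R := by
  rintro ⟨f, h0, hf⟩
  have hRV : G.An R ⊆ G.verts := G.ancestral_verts.An_subset hR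
  have hA : ∀ k, f k ⊆ G.An R := by
    intro k
    induction k with
    | zero => exact h0 ▸ G.subset_An R
    | succ k ih => exact (hf k).1.subset_of_ancestral (G.ancestral_An R) ih
  have hmono : StrictMono f :=
    strictMono_nat_of_lt_succ fun k => (hf k).1.ssubset hR (hA k) (hf k).2
  exact Set.infinite_range_of_injective hmono.injective
    (G.finite_verts.finite_subsets.subset (by
      rintro _ ⟨k, rfl⟩
      exact (hA k).trans hRV))

end Algorithm

end FinDAG

theorem theorem4p7 {V : Type*} (G : FinDAG V) (R : Set V) (hR : R ⊆ G.verts) :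
    ¬ G.CMDSADiverges R ∧
      (∃ K, G.CMDSAReturns R K) ∧
      ∀ K, G.CMDSAReturns R K → G.IsDConvexHull R K := by
  refine ⟨FinDAG.not_CMDSADiverges hR, ?_, ?_⟩
  · obtain ⟨H, h⟩ := FinDAG.exists_CMDSALoop hR R (G.subset_An R)
    exact ⟨_, H, h, rfl⟩
  · rintro _ ⟨H, h, rfl⟩
    obtain ⟨h1, h2, h3, h4⟩ := h.spec hR (G.subset_An R)
    refine ⟨⟨H, h2, rfl, (FinDAG.moralConvex_iff h2).1 h3⟩, fun x hx => ⟨hR hx, h1 hx⟩, ?_⟩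
    rintro _ ⟨T, hTV, rfl, hT⟩ hRT
    have hHT : H ⊆ T :=
      h4 T ((FinDAG.moralConvex_iff hTV).2 hT) hTV fun x hx => (hRT hx).2
    exact ⟨Set.inter_subset_inter_right _ hHT, fun u v e => ⟨e.1, hHT e.2.1, hHT e.2.2⟩⟩
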